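/- Let $G$ be a finite simple graph with vertex set $V(G)$, edge set $E(G)$ and $m = |E(G)|$ edges. For a map $f$ from $E(G)$ to the positive integers and a vertex $v$, let $\phi_f(v) = \sum_{e \ni v} f(e)$ be the sum of the labels of all edges incident to $v$. A strongly antimagic labeling of $G$ is a bijection $f : E(G) \to \{1, 2, \ldots, m\}$ such that $\phi_f(u) \neq \phi_f(v)$ for all distinct vertices $u, v$, and $\phi_f(u) > \phi_f(v)$ whenever $\deg(u) > \deg(v)$. The graph $G$ is strongly antimagic if it admits a strongly antimagic labeling. Corollary. Let $T$ be a finite tree that does not have exactly two vertices (that is, $T$ is not the single edge $P_2$). If $T$ has at most one vertex of even degree, then $T$ is strongly antimagic. -/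

import Mathlib

/-- The vertex sum `φ_f(v)`: the sum of the labels `f e` over all edges `e` of `G` incident
to `v`. -/
def vertexSum {V : Type*} [Fintype V] [DecidableEq V] (G : SimpleGraph V) [DecidableRel G.Adj]
    (f : Sym2 V → ℕ) (v : V) : ℕ :=
  ∑ e ∈ G.incidenceFinset v, f e

/-- `f` restricts to a bijection from the edges of `G` to `{1, …, m}`, where `m` is the number of
edges, and distinct vertices have distinct vertex sums. Only the values of `f` on edges of `G`
matter. -/
structure IsAntimagicLabeling {V : Type*} [Fintype V] [DecidableEq V] (G : SimpleGraph V)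
    [DecidableRel G.Adj] (f : Sym2 V → ℕ) : Prop where
  bijOn : Set.BijOn f G.edgeSet (Set.Icc 1 G.edgeFinset.card)
  vertexSum_ne : ∀ u v : V, u ≠ v → vertexSum G f u ≠ vertexSum G f v

/-- An antimagic labeling in which a vertex of larger degree has a larger vertex sum. -/
structure IsStronglyAntimagicLabeling {V : Type*} [Fintype V] [DecidableEq V]
    (G : SimpleGraph V) [DecidableRel G.Adj] (f : Sym2 V → ℕ) : Prop
    extends IsAntimagicLabeling G f where
  vertexSum_lt : ∀ u v : V, G.degree v < G.degree u → vertexSum G f v < vertexSum G f u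

/-- A finite graph is strongly antimagic if it admits a strongly antimagic labeling. -/
def IsStronglyAntimagic {V : Type*} [Fintype V] [DecidableEq V] (G : SimpleGraph V)
    [DecidableRel G.Adj] : Prop :=
  ∃ f : Sym2 V → ℕ, IsStronglyAntimagicLabeling G f

/-! Root the tree at `r` so that every other vertex has odd degree, hence an even number of
children. Pairing siblings with labels `i` and `m + 1 - i` makes the child edges at each vertex
average `(m + 1) / 2`. A non-root vertex of degree `2k + 1` then has sum `k(m + 1)` plus its parent
label in `[1, m]`: sums are ordered by degree first, then by distinct parent labels. The root has
sum `deg(r)(m + 1) / 2`, which falls into place by degree; only a tie in degree needs care, and the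
choice of `r` settles it. -/

open Finset in
/-- If all fibres of `p` on `S` except possibly the one over `r` are even, then `S` can be labelled
bijectively by `#S` consecutive integers so that every fibre has average label the mean. -/
theorem exists_balanced_labeling {α β : Type*} [DecidableEq α] [DecidableEq β] (p : α → β) (r : β)
    (n : ℕ) : ∀ (S : Finset α) (a : ℕ), #S = n → (∀ y, y ≠ r → Even #{x ∈ S | p x = y}) →
    ∃ l : α → ℕ, Set.BijOn l S (Set.Icc (a + 1) (a + n)) ∧
      ∀ y, 2 * ∑ x ∈ S with p x = y, l x = #{x ∈ S | p x = y} * (2 * a + n + 1) := by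
  induction n using Nat.strong_induction_on with
  | _ n ih =>
  intro S a hn hS
  -- With `p` injective, fibres have at most one element, so those over `y ≠ r` are empty and `S`
  -- has at most one point. Otherwise two points of one fibre can be peeled off.
  by_cases hp : Set.InjOn p (S : Set α)
  · rcases S.eq_empty_or_nonempty with rfl | ⟨c, hc⟩
    · obtain rfl : n = 0 := by simpa using hn.symm
      exact ⟨fun _ => 0, by simp, by simp⟩
    · have key : ∀ x ∈ S, p x = r := by
        intro x hx
        by_contra hne
        have h1 : ({z ∈ S | p z = p x} : Finset α) = {x} := by
          ext z
          simp only [mem_filter, mem_singleton]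
          exact ⟨fun h => hp h.1 hx h.2, by rintro rfl; exact ⟨hx, rfl⟩⟩
        have := hS (p x) hne
        rw [h1] at this
        simp at this
      have hSc : S = {c} := by
        ext z
        simp only [mem_singleton]
        exact ⟨fun h => hp h hc ((key z h).trans (key c hc).symm), by rintro rfl; exact hc⟩
      subst hSc
      obtain rfl : n = 1 := by simpa using hn.symm
      refine ⟨fun _ => a + 1, by simp [Set.BijOn, Set.MapsTo, Set.SurjOn], fun y => ?_⟩
      rw [sum_const, smul_eq_mul]
      ring
  · obtain ⟨x, hx, x', hx', hxx, hne⟩ : ∃ x ∈ S, ∃ x' ∈ S, p x = p x' ∧ x ≠ x' := by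
      simpa [Set.InjOn] using hp
    obtain ⟨T, hxT, hx'T, rfl⟩ : ∃ T : Finset α, x ∉ T ∧ x' ∉ T ∧ S = insert x (insert x' T) := by
      refine ⟨(S.erase x).erase x', by simp, by simp, ?_⟩
      rw [insert_erase (by simp [hx', hne.symm]), insert_erase hx]
    have hcard : #T + 2 = n := by
      rw [← hn, card_insert_of_notMem (by simp [hne, hxT]), card_insert_of_notMem hx'T]
    have hfib : ∀ y, #{z ∈ insert x (insert x' T) | p z = y} =
        #{z ∈ T | p z = y} + if p x = y then 2 else 0 := by
      intro y
      by_cases hy : p x = y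
      · rw [filter_insert, if_pos hy, filter_insert, if_pos (hxx ▸ hy),
          card_insert_of_notMem (by simp [hne, hxT]), card_insert_of_notMem (by simp [hx'T]),
          if_pos hy]
      · rw [filter_insert, if_neg hy, filter_insert, if_neg (hxx ▸ hy), if_neg hy, add_zero]
    obtain ⟨l, hl, hsum⟩ := ih #T (by omega) T (a + 1) rfl (fun y hy => by
      have := hS y hy
      rw [hfib] at this
      split_ifs at this
      · exact (Nat.even_add.mp this).mpr even_two
      · exact this)
    -- The peeled pair takes the two extreme labels, so the inner interval keeps the same mean.
    let l' : α → ℕ := fun z => if z = x then a + 1 else if z = x' then a + n else l z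
    have hlx : l' x = a + 1 := if_pos rfl
    have hlx' : l' x' = a + n := by simp [l', hne.symm]
    have hlT : ∀ z ∈ T, l' z = l z := by
      intro z hz
      have h1 : z ≠ x := by rintro rfl; exact hxT hz
      have h2 : z ≠ x' := by rintro rfl; exact hx'T hz
      simp [l', h1, h2]
    refine ⟨l', ?_, fun y => ?_⟩
    · have h1 : Set.BijOn l' T (Set.Icc (a + 1 + 1) (a + 1 + #T)) :=
        hl.congr fun z hz => (hlT z hz).symm
      have h2 := h1.insert (a := x') (by rw [hlx', Set.mem_Icc]; omega)
      have h3 := h2.insert (a := x) (by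
        rw [hlx, hlx', Set.mem_insert_iff, Set.mem_Icc]; omega)
      rw [hlx, hlx'] at h3
      convert h3 using 1
      · simp
      · ext k
        simp only [Set.mem_Icc, Set.mem_insert_iff]
        omega
    · have hT : ∑ z ∈ T with p z = y, l' z = ∑ z ∈ T with p z = y, l z :=
        sum_congr rfl fun z hz => hlT z (mem_filter.mp hz).1
      have hs := hsum y
      rw [hfib]
      by_cases hy : p x = y
      · rw [filter_insert, if_pos hy, filter_insert, if_pos (hxx ▸ hy),
          sum_insert (by simp [hne, hxT]), sum_insert (by simp [hx'T]), if_pos hy, hlx, hlx', hT,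
          ← add_assoc, mul_add, hs, ← hcard]
        ring
      · rw [filter_insert, if_neg hy, filter_insert, if_neg (hxx ▸ hy), if_neg hy, hT, hs, ← hcard]
        ring

/-- A rooted tree has a parent map, and sending a non-root vertex to the edge to its parent is a
bijection onto the edges. -/
theorem SimpleGraph.IsTree.exists_parent {V : Type*} [Fintype V] [DecidableEq V]
    {G : SimpleGraph V} [DecidableRel G.Adj] (hG : G.IsTree) (r : V) :
    ∃ p : V → V, (∀ v, v ≠ r → G.Adj v (p v)) ∧
      Set.InjOn (fun v => s(v, p v)) (Finset.univ.erase r : Finset V) ∧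
      (Finset.univ.erase r).image (fun v => s(v, p v)) = G.edgeFinset := by
  have hex : ∀ v, ∃ w, v ≠ r → G.Adj v w ∧ G.dist v r = G.dist w r + 1 := by
    intro v
    by_cases hv : v = r
    · exact ⟨v, fun h => absurd hv h⟩
    · obtain ⟨w, hw⟩ := hG.connected.exists_walk_length_eq_dist v r
      cases w with
      | nil => exact absurd rfl hv
      | @cons _ u _ h q =>
        refine ⟨u, fun _ => ⟨h, ?_⟩⟩
        have h1 := SimpleGraph.dist_le q
        have h2 : G.dist v r ≤ G.dist v u + G.dist u r := hG.connected.dist_triangle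
        rw [SimpleGraph.dist_eq_one_iff_adj.mpr h] at h2
        rw [SimpleGraph.Walk.length_cons] at hw
        omega
  choose p hp using hex
  -- If two vertices were each other's parent, each would be farther from `r` than the other.
  have hinj : Set.InjOn (fun v => s(v, p v)) (Finset.univ.erase r : Finset V) := by
    intro v hv w hw h
    have hv := (hp v (by simpa using hv)).2
    have hw := (hp w (by simpa using hw)).2
    rcases Sym2.eq_iff.mp h with h | ⟨h1, h2⟩
    · exact h.1
    · rw [h2] at hv
      rw [← h1] at hw
      omega
  refine ⟨p, fun v hv => (hp v hv).1, hinj, Finset.eq_of_subset_of_card_le ?_ ?_⟩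
  · intro e he
    obtain ⟨v, hv, rfl⟩ := Finset.mem_image.mp he
    simpa using (hp v (by simpa using hv)).1
  · have := hG.card_edgeFinset
    rw [Finset.card_image_of_injOn hinj, Finset.card_erase_of_mem (Finset.mem_univ r),
      Finset.card_univ]
    omega

open Finset in
/-- In a tree whose non-root vertices all have odd degree, the edges can be labelled bijectively so
that, with `l v` the label of the edge from `v` to its parent, the vertex sums are determined
by `l` and the degrees. -/
theorem SimpleGraph.IsTree.exists_balanced_labeling {V : Type*} [Fintype V] [DecidableEq V]
    {G : SimpleGraph V} [DecidableRel G.Adj] (hG : G.IsTree) (r : V)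
    (hodd : ∀ v, v ≠ r → Odd (G.degree v)) :
    ∃ (f : Sym2 V → ℕ) (p : V → V), Set.BijOn f G.edgeSet (Set.Icc 1 #G.edgeFinset) ∧
      (∀ v, v ≠ r → G.Adj v (p v)) ∧
      Set.InjOn (fun v => s(v, p v)) (univ.erase r : Finset V) ∧
      (∀ v, v ≠ r → 2 * vertexSum G f v + (#G.edgeFinset + 1) =
        2 * f s(v, p v) + G.degree v * (#G.edgeFinset + 1)) ∧
      2 * vertexSum G f r = G.degree r * (#G.edgeFinset + 1) := by
  obtain ⟨p, hadj, hinj, himg⟩ := hG.exists_parent r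
  have hm : #(univ.erase r) = #G.edgeFinset := by rw [← himg, card_image_of_injOn hinj]
  have hinc : ∀ v, G.incidenceFinset v =
      ({w ∈ univ.erase r | w = v ∨ p w = v} : Finset V).image (fun w => s(w, p w)) := by
    intro v
    ext e
    rw [SimpleGraph.incidenceFinset_eq_filter, ← himg]
    simp only [mem_filter, mem_image]
    constructor
    · rintro ⟨⟨w, hw, rfl⟩, he⟩
      exact ⟨w, ⟨hw, by simpa [eq_comm] using he⟩, rfl⟩
    · rintro ⟨w, ⟨hw, he⟩, rfl⟩
      exact ⟨⟨w, hw, rfl⟩, by simpa [eq_comm] using he⟩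
  have hsub : ∀ v, Set.InjOn (fun w => s(w, p w))
      ({w ∈ univ.erase r | w = v ∨ p w = v} : Finset V) := fun v =>
    hinj.mono (coe_subset.mpr (filter_subset _ _))
  have hroot : ({w ∈ univ.erase r | w = r ∨ p w = r} : Finset V) =
      {w ∈ univ.erase r | p w = r} := by
    ext w
    simp only [mem_filter, mem_erase]
    tauto
  have hnon : ∀ v, v ≠ r → ({w ∈ univ.erase r | w = v ∨ p w = v} : Finset V) =
      insert v {w ∈ univ.erase r | p w = v} := by
    intro v hv
    ext w
    simp only [mem_filter, mem_erase, mem_insert, mem_univ, and_true]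
    constructor
    · tauto
    · rintro (rfl | h)
      · exact ⟨hv, Or.inl rfl⟩
      · exact ⟨h.1, Or.inr h.2⟩
  have hnot : ∀ v, v ≠ r → v ∉ ({w ∈ univ.erase r | p w = v} : Finset V) := by
    intro v hv h
    exact (hadj v hv).ne (mem_filter.mp h).2.symm
  have hdeg : ∀ v, G.degree v = #{w ∈ univ.erase r | w = v ∨ p w = v} := by
    intro v
    rw [← SimpleGraph.card_incidenceFinset_eq_degree, hinc, card_image_of_injOn (hsub v)]
  have hdeg' : ∀ v, v ≠ r → G.degree v = #{w ∈ univ.erase r | p w = v} + 1 := by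
    intro v hv
    rw [hdeg, hnon v hv, card_insert_of_notMem (hnot v hv)]
  obtain ⟨l, hl, hsum⟩ := _root_.exists_balanced_labeling p r #G.edgeFinset (univ.erase r) 0 hm
    (fun v hv => by
      have := hodd v hv
      rw [hdeg' v hv] at this
      simpa [parity_simps] using this)
  have : Nonempty V := ⟨r⟩
  let g := Function.invFunOn (fun w => s(w, p w)) (univ.erase r : Finset V)
  have hg : ∀ w ∈ univ.erase r, g s(w, p w) = w := fun w hw =>
    hinj.leftInvOn_invFunOn (mem_coe.mpr hw)
  have hvs : ∀ v, vertexSum G (l ∘ g) v = ∑ w ∈ univ.erase r with w = v ∨ p w = v, l w := by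
    intro v
    rw [vertexSum, hinc, sum_image (hsub v)]
    exact sum_congr rfl fun w hw => congrArg l (hg w (mem_filter.mp hw).1)
  refine ⟨l ∘ g, p, ?_, hadj, hinj, fun v hv => ?_, ?_⟩
  · have hb : Set.BijOn (fun w => s(w, p w)) (univ.erase r : Finset V) G.edgeSet := by
      rw [← SimpleGraph.coe_edgeFinset, ← himg, coe_image]
      exact hinj.bijOn_image
    have hgb : Set.BijOn g G.edgeSet (univ.erase r : Finset V) :=
      (Set.bijOn_comm hb.invOn_invFunOn.symm).mp hb
    simpa using hl.comp hgb
  · have := hsum v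
    rw [hvs, hnon v hv, sum_insert (hnot v hv), mul_add, this, hdeg' v hv, Function.comp_apply,
      hg v (by simpa using hv)]
    ring
  · have := hsum r
    rw [hvs, hdeg, hroot, this]
    ring

theorem mainTheorem11 {V : Type*} [Fintype V] [DecidableEq V] (G : SimpleGraph V)
    [DecidableRel G.Adj] (hG : G.IsTree) (hcard : Fintype.card V ≠ 2)
    (heven : ∀ u v : V, Even (G.degree u) → Even (G.degree v) → u = v) :
    IsStronglyAntimagic G := by
  -- The root is the even vertex if there is one, otherwise a leaf; two adjacent leaves would be the
  -- whole tree.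
  obtain ⟨r, hodd, hr⟩ : ∃ r, (∀ v, v ≠ r → Odd (G.degree v)) ∧
      (Even (G.degree r) ∨ G.degree r = 1 ∧ ∀ v, G.Adj v r → G.degree v ≠ 1) := by
    by_cases h : ∃ r, Even (G.degree r)
    · obtain ⟨r, hr⟩ := h
      exact ⟨r, fun v hv => Nat.not_even_iff_odd.mp fun h => hv (heven v r h hr), Or.inl hr⟩
    · push Not at h
      simp only [Nat.not_even_iff_odd] at h
      have := hG.connected.nonempty
      have : Nontrivial V := by
        obtain ⟨v⟩ := hG.connected.nonempty
        obtain ⟨w, hw⟩ := (G.degree_pos_iff_exists_adj v).mp (h v).pos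
        exact ⟨v, w, hw.ne⟩
      obtain ⟨r, hr⟩ := hG.exists_vert_degree_one_of_nontrivial
      refine ⟨r, fun v _ => h v, Or.inr ⟨hr, fun c hc hc1 => hcard ?_⟩⟩
      have hrc : ∀ x, G.Adj r x → x = c := fun x hx =>
        (G.degree_eq_one_iff_existsUnique_adj.mp hr).unique hx hc.symm
      have hcr : ∀ x, G.Adj c x → x = r := fun x hx =>
        (G.degree_eq_one_iff_existsUnique_adj.mp hc1).unique hx hc
      have hwalk : ∀ x y, G.Walk x y → (x = r ∨ x = c) → (y = r ∨ y = c) := by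
        intro x y q
        induction q with
        | nil => exact id
        | cons hxy _ ih =>
          rintro (rfl | rfl)
          · exact ih (Or.inr (hrc _ hxy))
          · exact ih (Or.inl (hcr _ hxy))
      have huniv : (Finset.univ : Finset V) = {r, c} := by
        ext x
        obtain ⟨q⟩ := hG.connected.preconnected r x
        simpa using hwalk r x q (Or.inl rfl)
      rw [← Finset.card_univ, huniv, Finset.card_pair hc.ne']
  obtain ⟨f, p, hf, hadj, hinj, hv, hroot⟩ := hG.exists_balanced_labeling r hodd
  set m := G.edgeFinset.card
  have hbd : ∀ v, v ≠ r → 1 ≤ f s(v, p v) ∧ f s(v, p v) ≤ m := fun v hvr =>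
    hf.mapsTo (hadj v hvr)
  have hform : ∀ v, v ≠ r → ∃ k, G.degree v = 2 * k + 1 ∧
      vertexSum G f v = f s(v, p v) + k * (m + 1) := by
    intro v hvr
    obtain ⟨k, hk⟩ := hodd v hvr
    refine ⟨k, hk, ?_⟩
    have := hv v hvr
    rw [hk] at this
    linarith
  have hlt_root : ∀ v, v ≠ r → G.degree v < G.degree r →
      vertexSum G f v < vertexSum G f r := by
    intro v hvr h
    obtain ⟨k, hk, hs⟩ := hform v hvr
    have hb := hbd v hvr
    -- Doubled sums avoid halving `m + 1`; strictness comes from the parent label being at most `m`.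
    have : (2 * k + 2) * (m + 1) ≤ G.degree r * (m + 1) := Nat.mul_le_mul_right _ (by omega)
    linarith
  have hroot_lt : ∀ v, v ≠ r → G.degree r < G.degree v →
      vertexSum G f r < vertexSum G f v := by
    intro v hvr h
    obtain ⟨k, hk, hs⟩ := hform v hvr
    have hb := hbd v hvr
    have : G.degree r * (m + 1) ≤ (2 * k) * (m + 1) := Nat.mul_le_mul_right _ (by omega)
    linarith
  have hlt : ∀ u v, G.degree v < G.degree u → vertexSum G f v < vertexSum G f u := by
    intro u v h
    by_cases hvr : v = r
    · subst hvr
      exact hroot_lt u (by rintro rfl; exact h.false) h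
    by_cases hur : u = r
    · subst hur
      exact hlt_root v hvr h
    obtain ⟨k, hk, hs⟩ := hform v hvr
    obtain ⟨j, hj, ht⟩ := hform u hur
    have hb := hbd v hvr
    have hc := hbd u hur
    have : (k + 1) * (m + 1) ≤ j * (m + 1) := Nat.mul_le_mul_right _ (by omega)
    linarith
  have hne_root : ∀ v, v ≠ r → G.degree v = G.degree r →
      vertexSum G f v ≠ vertexSum G f r := by
    intro v hvr hd hs
    rcases hr with hr | ⟨hr, hadj_r⟩
    · exact Nat.not_even_iff_odd.mpr (hodd v hvr) (hd ▸ hr)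
    -- A leaf root's sum is the label of its only edge, so a leaf with the same sum shares that
    -- edge.
    · obtain ⟨c, hc⟩ := (G.degree_pos_iff_exists_adj r).mp (by omega)
      have hsum_r : vertexSum G f r = f s(r, c) := by
        obtain ⟨e, he⟩ := Finset.card_eq_one.mp
          ((G.card_incidenceFinset_eq_degree r).trans hr)
        have : s(r, c) ∈ G.incidenceFinset r := by
          simpa [SimpleGraph.incidenceSet] using hc
        rw [he, Finset.mem_singleton] at this
        rw [vertexSum, he, Finset.sum_singleton, this]
      obtain ⟨k, hk, ht⟩ := hform v hvr
      obtain rfl : k = 0 := by omega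
      have heq : s(v, p v) = s(r, c) :=
        hf.injOn (hadj v hvr) hc (by rw [← hsum_r, ← hs, ht]; ring)
      rcases Sym2.eq_iff.mp heq with h | h
      · exact hvr h.1
      · exact hadj_r v (h.1 ▸ hc.symm) (by omega)
  refine ⟨f, ⟨⟨hf, fun u v huv hs => ?_⟩, hlt⟩⟩
  rcases lt_trichotomy (G.degree u) (G.degree v) with h | h | h
  · exact (hlt v u h).ne hs
  · by_cases hur : u = r
    · subst hur
      exact hne_root v huv.symm h.symm hs.symm
    by_cases hvr : v = r
    · subst hvr
      exact hne_root u huv h hs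
    obtain ⟨k, hk, hk'⟩ := hform u hur
    obtain ⟨j, hj, hj'⟩ := hform v hvr
    obtain rfl : k = j := by omega
    have heq : s(u, p u) = s(v, p v) :=
      hf.injOn (hadj u hur) (hadj v hvr) (by omega)
    exact huv (hinj (by simpa using hur) (by simpa using hvr) heq)
  · exact (hlt u v h).ne' hs
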